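/- Let $\mathcal C$ be a finite family of closed squares in the Euclidean plane $\mathbb R^2$, of positive side lengths and with arbitrary positions, sizes and orientations (repeated squares are allowed). For a point $p\in\mathbb R^2$ let the degree of $p$ be the number of members of $\mathcal C$ that contain $p$, and let $\Delta(\mathcal C)$ be the maximum degree over all points of the plane. Let $\chi(\mathcal C)$ be the chromatic number of the intersection graph of $\mathcal C$ (two distinct members are adjacent if and only if they have a common point), that is, the minimum number of classes in a partition of $\mathcal C$ into subfamilies of pairwise disjoint squares. 1. If $\Delta(\mathcal C)\ge 2$, then $\chi(\mathcal C)\le 9(\Delta(\mathcal C)-1)$. 2. If all the squares of $\mathcal C$ have equal size, then $\chi(\mathcal C)\le 6\,\Delta(\mathcal C)$. -/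

import Mathlib

/-- The Euclidean plane. -/
abbrev Plane : Type := EuclideanSpace ℝ (Fin 2)

/-- `S` is a (closed, filled, arbitrarily rotated) square of side length `s > 0`: for some centre
`c` and some orthonormal pair of directions `u`, `v` of the sides, `S` is the set of the points
whose coordinates relative to `c` along `u` and along `v` are at most `s / 2` in absolute value. -/
def IsSquareOfSide (s : ℝ) (S : Set Plane) : Prop :=
  0 < s ∧ ∃ c u v : Plane, ‖u‖ = 1 ∧ ‖v‖ = 1 ∧ inner ℝ u v = 0 ∧
    S = {x : Plane | |inner ℝ (x - c) u| ≤ s / 2 ∧ |inner ℝ (x - c) v| ≤ s / 2}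

/-- `S` is a square in the plane, of any positive size, position and orientation. -/
def IsPlaneSquare (S : Set Plane) : Prop :=
  ∃ s : ℝ, IsSquareOfSide s S

/-- The intersection graph of a family of sets: two distinct members are adjacent if and only if
they have a common point. -/
def intersectionGraph {ι : Type*} (F : ι → Set Plane) : SimpleGraph ι where
  Adj i j := i ≠ j ∧ (F i ∩ F j).Nonempty
  symm := ⟨fun _ _ h => ⟨h.1.symm, by rw [Set.inter_comm]; exact h.2⟩⟩
  loopless := ⟨fun _ h => h.1 rfl⟩

/-- The chromatic number of a family of sets: the chromatic number of its intersection graph. -/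
noncomputable def familyChromaticNumber {ι : Type*} (F : ι → Set Plane) : ℕ∞ :=
  (intersectionGraph F).chromaticNumber

/-- The degree of the point `p` in a family of sets: the number of members containing `p`. -/
noncomputable def pointDegree {ι : Type*} (F : ι → Set Plane) (p : Plane) : ℕ :=
  {i : ι | p ∈ F i}.ncard

/-- The maximum degree of a (finite) family of sets, over all points of the plane. -/
noncomputable def maxPointDegree {ι : Type*} (F : ι → Set Plane) : ℕ :=
  sSup (Set.range (pointDegree F))

/-- For a finite family the supremum defining `maxPointDegree` is a maximum. -/
theorem isGreatest_maxPointDegree {ι : Type*} [Finite ι] (F : ι → Set Plane) :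
    IsGreatest (Set.range (pointDegree F)) (maxPointDegree F) := by
  have hb : BddAbove (Set.range (pointDegree F)) := by
    refine ⟨Nat.card ι, ?_⟩
    rintro _ ⟨p, rfl⟩
    exact Set.ncard_le_card _
  exact ⟨Nat.sSup_mem (Set.range_nonempty _) hb, fun _ h => le_csSup hb h⟩

/-! Both bounds are degeneracy bounds: if every nonempty subfamily has a member meeting fewer than
`k` others of it, greedy colouring uses `k` colours. For equal sizes, take a member whose centre is
lowest in a fixed direction. Six points pierce every congruent square that meets it and is not lower
(`exists_piercing_points`), and one of them lies in the member itself, so it has at most `6Δ - 1`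
neighbours. The points are explicit, one set for each of three sectors of directions, and are
certified by an integer branch and bound over centre and rotation. For arbitrary sizes, let a square
charge another 2 for each of its corners, and 1 for its centre, lying in the other. Two squares that
meet charge each other at least 2 in total (`squareSet_corner_or_centers`), while a square charges
at most `(4·2 + 1)(Δ - 1)`. Hence the average degree is at most `9(Δ - 1)`. If all degrees reached
this bound, every inequality would be tight; but then a corner farthest from the origin lies in a
second square, is a corner of it too, and that pair is charged at least 4. -/

open scoped InnerProductSpace

/-! ### Integer branch and bound for the piercing points -/

/-- Strict positivity of the linear form `α N + β C + γ S` at the control point with parameters `p`,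
`q` of the arc `τ ↦ (N, C, S) = (100² + τ², 100² - τ², 200 τ)`. -/
def ctrlPos (p q α β γ : ℤ) : Bool :=
  decide (0 < α * (10000 + p * q) + β * (10000 - p * q) + γ * (100 * (p + q)))

/-- A sufficient condition for `α N + β C + γ S` to be positive for all `τ` in `[a, b]`. -/
def arcPos (a b α β γ : ℤ) : Bool :=
  ctrlPos a b α β γ && (ctrlPos a a α β γ && ctrlPos b b α β γ)

/-- All squares of half side `100` with centre in the box and direction parameter in `[a, b]` are
strictly separated from `[-100, 100]²` by a line along a side of one of the two squares. -/
def boxSeparated (x₀ x₁ y₀ y₁ a b : ℤ) : Bool :=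
  -- The candidate axes are the normals to the sides of both squares, with either sign; on each axis
  -- the half widths add up to `100 (N + C + S) / N`.
  arcPos a b (x₀ - 100) (-100) (-100) || (arcPos a b (-x₁ - 100) (-100) (-100) ||
  (arcPos a b (y₀ - 100) (-100) (-100) || (arcPos a b (-y₁ - 100) (-100) (-100) ||
  (arcPos a b (-100) (x₀ - 100) (y₀ - 100) || (arcPos a b (-100) (-x₁ - 100) (-y₁ - 100) ||
  (arcPos a b (-100) (y₀ - 100) (-x₁ - 100) || arcPos a b (-100) (-y₁ - 100) (x₀ - 100)))))))

/-- The box lies in the open half plane `d₁ x + d₂ y < 0`, where `0 ≤ d₁, d₂`. -/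
def boxBehind (d : ℤ × ℤ) (x₁ y₁ : ℤ) : Bool :=
  decide (d.1 * x₁ + d.2 * y₁ < 0)

/-- All squares of half side `100` with centre in the box and direction parameter in `[a, b]`
contain the point `p`. -/
def boxPierced (p : ℤ × ℤ) (x₀ x₁ y₀ y₁ a b : ℤ) : Bool :=
  arcPos a b 100 (x₀ - p.1) (y₀ - p.2) && (arcPos a b 100 (p.1 - x₁) (p.2 - y₁) &&
  (arcPos a b 100 (y₀ - p.2) (p.1 - x₁) && arcPos a b 100 (p.2 - y₁) (x₀ - p.1)))

/-- Branch and bound: bisect the box until each part is settled by one of the three tests. -/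
def pierceCheck (d e : ℤ × ℤ) (P : List (ℤ × ℤ)) : ℕ → ℤ → ℤ → ℤ → ℤ → ℤ → ℤ → Bool
  | 0, _, _, _, _, _, _ => false
  | k + 1, x₀, x₁, y₀, y₁, a, b =>
    (boxSeparated x₀ x₁ y₀ y₁ a b || ((boxBehind d x₁ y₁ && boxBehind e x₁ y₁) ||
      P.any fun p => boxPierced p x₀ x₁ y₀ y₁ a b)) ||
    -- The longest edge is cut at an integer shared by both halves, so nothing is lost to rounding.
    -- An edge of length at most 1 no longer shrinks; the fuel guarantees termination.
    bif decide (y₁ - y₀ ≤ x₁ - x₀) && decide (b - a ≤ x₁ - x₀) then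
      pierceCheck d e P k x₀ ((x₀ + x₁) / 2) y₀ y₁ a b &&
        pierceCheck d e P k ((x₀ + x₁) / 2) x₁ y₀ y₁ a b
    else bif decide (b - a ≤ y₁ - y₀) then
      pierceCheck d e P k x₀ x₁ y₀ ((y₀ + y₁) / 2) a b &&
        pierceCheck d e P k x₀ x₁ ((y₀ + y₁) / 2) y₁ a b
    else
      pierceCheck d e P k x₀ x₁ y₀ y₁ a ((a + b) / 2) &&
        pierceCheck d e P k x₀ x₁ y₀ y₁ ((a + b) / 2) b

/-- Piercing points for the directions of slope between `0` and `4 / 15`. -/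
def flatPoints : List (ℤ × ℤ) :=
  [(40, 9), (54, -170), (157, -144), (232, 18), (148, 167), (9, 182)]

/-- Piercing points for the directions of slope between `4 / 15` and `4 / 7`. -/
def middlePoints : List (ℤ × ℤ) :=
  [(34, 12), (105, -149), (193, -99), (210, 94), (109, 190), (-55, 184)]

/-- Piercing points for the directions of slope between `4 / 7` and `1`. -/
def steepPoints : List (ℤ × ℤ) :=
  [(31, 24), (130, -127), (215, -25), (176, 148), (41, 214), (-105, 157)]

/-- Lengths are in hundredths of the half side. The box `±250` contains every centre that matters,
and the parameter range `[0, 100]` covers the rotations by 0 to 90 degrees. -/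
theorem pierceCheck_flat :
    pierceCheck (1, 0) (15, 4) flatPoints 30 (-250) 250 (-250) 250 0 100 = true := by
  decide +kernel

theorem pierceCheck_middle :
    pierceCheck (15, 4) (7, 4) middlePoints 30 (-250) 250 (-250) 250 0 100 = true := by
  decide +kernel

theorem pierceCheck_steep :
    pierceCheck (7, 4) (1, 1) steepPoints 30 (-250) 250 (-250) 250 0 100 = true := by
  decide +kernel

/-! ### Soundness of the integer tests over the reals -/

/-- The form is quadratic in `t`, and the three control values are its Bernstein coefficients on
`[a, b]`. -/
theorem arcPos_sound {a b α β γ : ℤ} (h : arcPos a b α β γ = true) {t : ℝ} (ha : (a : ℝ) ≤ t)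
    (hb : t ≤ b) : 0 < α * (10000 + t ^ 2) + β * (10000 - t ^ 2) + γ * (200 * t) := by
  simp only [arcPos, ctrlPos, Bool.and_eq_true, decide_eq_true_eq] at h
  obtain ⟨h₁, h₀, h₂⟩ := h
  have h₀' : (0 : ℝ) < α * (10000 + a * a) + β * (10000 - a * a) + γ * (100 * (a + a)) := by
    exact_mod_cast h₀
  have h₁' : (0 : ℝ) < α * (10000 + a * b) + β * (10000 - a * b) + γ * (100 * (a + b)) := by
    exact_mod_cast h₁
  have h₂' : (0 : ℝ) < α * (10000 + b * b) + β * (10000 - b * b) + γ * (100 * (b + b)) := by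
    exact_mod_cast h₂
  rcases eq_or_lt_of_le ha with rfl | hlt
  · linarith
  · have e : ((b : ℝ) - a) ^ 2 * (α * (10000 + t ^ 2) + β * (10000 - t ^ 2) + γ * (200 * t)) =
        (b - t) ^ 2 * (α * (10000 + a * a) + β * (10000 - a * a) + γ * (100 * (a + a))) +
        2 * ((b - t) * (t - a)) *
          (α * (10000 + a * b) + β * (10000 - a * b) + γ * (100 * (a + b))) +
        (t - a) ^ 2 * (α * (10000 + b * b) + β * (10000 - b * b) + γ * (100 * (b + b))) := by
      ring
    have hbt : 0 ≤ (b : ℝ) - t := by linarith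
    have hta : 0 < t - (a : ℝ) := by linarith
    refine pos_of_mul_pos_right (a := ((b : ℝ) - a) ^ 2) ?_ (by positivity)
    rw [e]
    have := mul_pos (pow_pos hta 2) h₂'
    positivity

/-- The square of half side `100`, centre `(x, y)` and direction parameter `t` is separated from
`[-100, 100]²`. -/
def Separated (x y t : ℝ) : Prop :=
  100 * ((10000 + t ^ 2) + (10000 - t ^ 2) + 200 * t) < |x| * (10000 + t ^ 2) ∨
  100 * ((10000 + t ^ 2) + (10000 - t ^ 2) + 200 * t) < |y| * (10000 + t ^ 2) ∨
  100 * ((10000 + t ^ 2) + (10000 - t ^ 2) + 200 * t) < |x * (10000 - t ^ 2) + y * (200 * t)| ∨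
  100 * ((10000 + t ^ 2) + (10000 - t ^ 2) + 200 * t) < |y * (10000 - t ^ 2) - x * (200 * t)|

/-- The square of half side `100`, centre `(x, y)` and direction parameter `t` contains `p`. -/
def Pierced (p : ℤ × ℤ) (x y t : ℝ) : Prop :=
  |(p.1 - x) * (10000 - t ^ 2) + (p.2 - y) * (200 * t)| ≤ 100 * (10000 + t ^ 2) ∧
  |(p.2 - y) * (10000 - t ^ 2) - (p.1 - x) * (200 * t)| ≤ 100 * (10000 + t ^ 2)

section Sound

variable {x₀ x₁ y₀ y₁ a b : ℤ} {x y t : ℝ}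

theorem boxSeparated_sound (h : boxSeparated x₀ x₁ y₀ y₁ a b = true) (hC : 0 ≤ 10000 - t ^ 2)
    (ht : 0 ≤ t) (hx₀ : x₀ ≤ x) (hx₁ : x ≤ x₁) (hy₀ : y₀ ≤ y) (hy₁ : y ≤ y₁) (ha : a ≤ t)
    (hb : t ≤ b) : Separated x y t := by
  simp only [boxSeparated, Bool.or_eq_true] at h
  have hN : 0 ≤ 10000 + t ^ 2 := by positivity
  have := mul_le_mul_of_nonneg_right hx₀ hN
  have := mul_le_mul_of_nonneg_right hx₁ hN
  have := mul_le_mul_of_nonneg_right hy₀ hN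
  have := mul_le_mul_of_nonneg_right hy₁ hN
  have := mul_le_mul_of_nonneg_right hx₀ hC
  have := mul_le_mul_of_nonneg_right hx₁ hC
  have := mul_le_mul_of_nonneg_right hy₀ hC
  have := mul_le_mul_of_nonneg_right hy₁ hC
  have := mul_le_mul_of_nonneg_right hx₀ ht
  have := mul_le_mul_of_nonneg_right hx₁ ht
  have := mul_le_mul_of_nonneg_right hy₀ ht
  have := mul_le_mul_of_nonneg_right hy₁ ht
  have hx : |x| * (10000 + t ^ 2) = |x * (10000 + t ^ 2)| := by rw [abs_mul, abs_of_nonneg hN]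
  have hy : |y| * (10000 + t ^ 2) = |y * (10000 + t ^ 2)| := by rw [abs_mul, abs_of_nonneg hN]
  unfold Separated
  rw [hx, hy]
  simp only [lt_abs]
  rcases h with h | h | h | h | h | h | h | h <;> have h := arcPos_sound h ha hb <;>
    push_cast at h
  · exact Or.inl (Or.inl (by linarith))
  · exact Or.inl (Or.inr (by linarith))
  · exact Or.inr (Or.inl (Or.inl (by linarith)))
  · exact Or.inr (Or.inl (Or.inr (by linarith)))
  · exact Or.inr (Or.inr (Or.inl (Or.inl (by linarith))))
  · exact Or.inr (Or.inr (Or.inl (Or.inr (by linarith))))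
  · exact Or.inr (Or.inr (Or.inr (Or.inl (by linarith))))
  · exact Or.inr (Or.inr (Or.inr (Or.inr (by linarith))))

theorem boxPierced_sound {p : ℤ × ℤ} (h : boxPierced p x₀ x₁ y₀ y₁ a b = true)
    (hC : 0 ≤ 10000 - t ^ 2) (ht : 0 ≤ t) (hx₀ : x₀ ≤ x) (hx₁ : x ≤ x₁) (hy₀ : y₀ ≤ y)
    (hy₁ : y ≤ y₁) (ha : a ≤ t) (hb : t ≤ b) : Pierced p x y t := by
  simp only [boxPierced, Bool.and_eq_true] at h
  obtain ⟨h₁, h₂, h₃, h₄⟩ := h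
  have h₁ := arcPos_sound h₁ ha hb
  have h₂ := arcPos_sound h₂ ha hb
  have h₃ := arcPos_sound h₃ ha hb
  have h₄ := arcPos_sound h₄ ha hb
  push_cast at h₁ h₂ h₃ h₄
  have := mul_le_mul_of_nonneg_right hx₀ hC
  have := mul_le_mul_of_nonneg_right hx₁ hC
  have := mul_le_mul_of_nonneg_right hy₀ hC
  have := mul_le_mul_of_nonneg_right hy₁ hC
  have := mul_le_mul_of_nonneg_right hx₀ ht
  have := mul_le_mul_of_nonneg_right hx₁ ht
  have := mul_le_mul_of_nonneg_right hy₀ ht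
  have := mul_le_mul_of_nonneg_right hy₁ ht
  constructor <;> rw [abs_le] <;> constructor <;> linarith

theorem boxBehind_sound {d : ℤ × ℤ} (h : boxBehind d x₁ y₁ = true) (hd₁ : 0 ≤ d.1)
    (hd₂ : 0 ≤ d.2) (hx₁ : x ≤ x₁) (hy₁ : y ≤ y₁) : d.1 * x + d.2 * y < 0 := by
  simp only [boxBehind, decide_eq_true_eq] at h
  have h' : (d.1 : ℝ) * x₁ + d.2 * y₁ < 0 := by exact_mod_cast h
  have hd₁' : (0 : ℝ) ≤ d.1 := by exact_mod_cast hd₁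
  have hd₂' : (0 : ℝ) ≤ d.2 := by exact_mod_cast hd₂
  nlinarith [mul_le_mul_of_nonneg_left hx₁ hd₁', mul_le_mul_of_nonneg_left hy₁ hd₂']

theorem pierceCheck_sound {d e : ℤ × ℤ} (hd₁ : 0 ≤ d.1) (hd₂ : 0 ≤ d.2) (he₁ : 0 ≤ e.1)
    (he₂ : 0 ≤ e.2) {P : List (ℤ × ℤ)} {k : ℕ} (h : pierceCheck d e P k x₀ x₁ y₀ y₁ a b = true)
    (hC : 0 ≤ 10000 - t ^ 2) (ht : 0 ≤ t) (hx₀ : x₀ ≤ x) (hx₁ : x ≤ x₁) (hy₀ : y₀ ≤ y)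
    (hy₁ : y ≤ y₁) (ha : a ≤ t) (hb : t ≤ b) :
    Separated x y t ∨ (d.1 * x + d.2 * y < 0 ∧ e.1 * x + e.2 * y < 0) ∨
      ∃ p ∈ P, Pierced p x y t := by
  induction k generalizing x₀ x₁ y₀ y₁ a b with
  | zero => simp [pierceCheck] at h
  | succ k ih =>
    rw [pierceCheck, Bool.or_eq_true, Bool.or_eq_true, Bool.or_eq_true, Bool.and_eq_true,
      List.any_eq_true] at h
    rcases h with (h | ⟨h, h'⟩ | ⟨p, hp, h⟩) | h
    · exact Or.inl (boxSeparated_sound h hC ht hx₀ hx₁ hy₀ hy₁ ha hb)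
    · exact Or.inr (Or.inl ⟨boxBehind_sound h hd₁ hd₂ hx₁ hy₁, boxBehind_sound h' he₁ he₂ hx₁ hy₁⟩)
    · exact Or.inr (Or.inr ⟨p, hp, boxPierced_sound h hC ht hx₀ hx₁ hy₀ hy₁ ha hb⟩)
    · rw [Bool.cond_eq_ite, Bool.cond_eq_ite] at h
      split_ifs at h <;> rw [Bool.and_eq_true] at h
      · rcases le_total x ((x₀ + x₁) / 2 : ℤ) with hm | hm
        · exact ih h.1 hx₀ hm hy₀ hy₁ ha hb
        · exact ih h.2 hm hx₁ hy₀ hy₁ ha hb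
      · rcases le_total y ((y₀ + y₁) / 2 : ℤ) with hm | hm
        · exact ih h.1 hx₀ hx₁ hy₀ hm ha hb
        · exact ih h.2 hx₀ hx₁ hm hy₁ ha hb
      · rcases le_total t ((a + b) / 2 : ℤ) with hm | hm
        · exact ih h.1 hx₀ hx₁ hy₀ hy₁ ha hm
        · exact ih h.2 hx₀ hx₁ hy₀ hy₁ hm hb

end Sound

/-! ### The six piercing points in coordinates -/

/-- Puts the half plane of an arbitrary direction of a sector inside the union of the half planes of
the two extreme directions, so that one check serves the whole sector. -/
theorem nonneg_or_nonneg_of_combination {α β u v : ℝ} (hα : 0 ≤ α) (hβ : 0 ≤ β) (hαβ : 0 < α + β)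
    (h : 0 ≤ α * u + β * v) : 0 ≤ u ∨ 0 ≤ v := by
  by_contra! hc
  rcases hα.eq_or_lt with rfl | hα
  · nlinarith
  · nlinarith [mul_neg_of_pos_of_neg hα hc.1, mul_nonpos_of_nonneg_of_nonpos hβ hc.2.le]

/-- Six points such that every unit square that meets the unit square centred at the origin, and
whose centre lies in a given half plane, contains one of them; the first lies in that square.
Both squares are scaled to half side `1`. -/
theorem exists_piercing_points {d₁ d₂ : ℝ} (hd₁ : 0 < d₁) (hd₂ : 0 ≤ d₂) (hd : d₂ ≤ d₁) :
    ∃ P : Fin 6 → ℝ × ℝ, |(P 0).1| ≤ 1 ∧ |(P 0).2| ≤ 1 ∧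
      ∀ x y c s : ℝ, 0 ≤ c → 0 ≤ s → c ^ 2 + s ^ 2 = 1 → 0 ≤ d₁ * x + d₂ * y →
        |x| ≤ 1 + c + s → |y| ≤ 1 + c + s → |x * c + y * s| ≤ 1 + c + s →
        |y * c - x * s| ≤ 1 + c + s →
        ∃ k, |((P k).1 - x) * c + ((P k).2 - y) * s| ≤ 1 ∧
          |((P k).2 - y) * c - ((P k).1 - x) * s| ≤ 1 := by
  obtain ⟨d, e, L, hL, hd₁', hd₂', he₁, he₂, h₁, h₂, hcheck, hde⟩ : ∃ (d e : ℤ × ℤ)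
      (L : List (ℤ × ℤ)) (hL : L.length = 6), 0 ≤ d.1 ∧ 0 ≤ d.2 ∧ 0 ≤ e.1 ∧ 0 ≤ e.2 ∧
      |(L[0].1 : ℝ)| ≤ 100 ∧ |(L[0].2 : ℝ)| ≤ 100 ∧
      pierceCheck d e L 30 (-250) 250 (-250) 250 0 100 = true ∧
      ∀ x y : ℝ, 0 ≤ d₁ * x + d₂ * y → 0 ≤ d.1 * x + d.2 * y ∨ 0 ≤ e.1 * x + e.2 * y := by
    -- In the three sectors the combination of the extreme directions equals `(d₁, d₂)` times 4, 32
    -- and 3 respectively.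
    rcases le_total (15 * d₂) (4 * d₁) with h | h
    · refine ⟨(1, 0), (15, 4), flatPoints, rfl, by norm_num, by norm_num, by norm_num, by norm_num,
        by norm_num [flatPoints], by norm_num [flatPoints], pierceCheck_flat, fun x y hxy => ?_⟩
      push_cast
      exact nonneg_or_nonneg_of_combination (α := 4 * d₁ - 15 * d₂) (β := d₂) (by linarith) hd₂
        (by linarith) (by linarith)
    rcases le_total (7 * d₂) (4 * d₁) with h' | h'
    · refine ⟨(15, 4), (7, 4), middlePoints, rfl, by norm_num, by norm_num, by norm_num,
        by norm_num, by norm_num [middlePoints], by norm_num [middlePoints], pierceCheck_middle,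
        fun x y hxy => ?_⟩
      push_cast
      exact nonneg_or_nonneg_of_combination (α := 4 * d₁ - 7 * d₂) (β := 15 * d₂ - 4 * d₁)
        (by linarith) (by linarith) (by linarith) (by linarith)
    · refine ⟨(7, 4), (1, 1), steepPoints, rfl, by norm_num, by norm_num, by norm_num,
        by norm_num, by norm_num [steepPoints], by norm_num [steepPoints], pierceCheck_steep,
        fun x y hxy => ?_⟩
      push_cast
      exact nonneg_or_nonneg_of_combination (α := d₁ - d₂) (β := 7 * d₂ - 4 * d₁)
        (by linarith) (by linarith) (by linarith) (by linarith)
  refine ⟨fun k => ((L[k].1 : ℝ) / 100, (L[k].2 : ℝ) / 100), ?_, ?_, ?_⟩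
  · change |(L[0].1 : ℝ) / 100| ≤ 1
    rw [abs_div, abs_of_pos (by norm_num : (0 : ℝ) < 100), div_le_one (by norm_num)]
    exact h₁
  · change |(L[0].2 : ℝ) / 100| ≤ 1
    rw [abs_div, abs_of_pos (by norm_num : (0 : ℝ) < 100), div_le_one (by norm_num)]
    exact h₂
  · intro x y c s hc hs hcs hxy hx hy hu hv
    -- Tangent of the half angle, times 100; then `(N, C, S) = M (1, c, s)`.
    set t : ℝ := 100 * (s / (1 + c)) with ht
    have hc1 : (0 : ℝ) < 1 + c := by linarith
    have ht0 : 0 ≤ t := by positivity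
    have hs1 : s ≤ 1 := by nlinarith
    have ht1 : t ≤ 100 := by
      have : s / (1 + c) ≤ 1 := by rw [div_le_one hc1]; linarith
      linarith
    have hM : 0 < 20000 / (1 + c) := by positivity
    set M : ℝ := 20000 / (1 + c) with hMdef
    have eN : 10000 + t ^ 2 = M := by
      rw [ht, hMdef]; field_simp; nlinarith
    have eC : 10000 - t ^ 2 = M * c := by
      rw [ht, hMdef]; field_simp; nlinarith
    have eS : 200 * t = M * s := by
      rw [ht, hMdef]; field_simp; ring
    -- This rational bound for `√2` gives `100 (1 + c + s) ≤ 250`, the size of the box.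
    have hb : c + s ≤ 3 / 2 := by nlinarith [sq_nonneg (c - s)]
    rw [abs_le] at hx hy
    have := pierceCheck_sound (x := 100 * x) (y := 100 * y) (t := t) hd₁' hd₂' he₁ he₂ hcheck
      (by rw [eC]; positivity) ht0 (by push_cast; linarith) (by push_cast; linarith)
      (by push_cast; linarith) (by push_cast; linarith) (by push_cast; linarith)
      (by push_cast; linarith)
    rcases this with h | h | ⟨p, hp, h⟩
    · exfalso
      have hx : |x| ≤ 1 + c + s := abs_le.2 hx
      have hy : |y| ≤ 1 + c + s := abs_le.2 hy
      unfold Separated at h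
      rw [eN, eC, eS] at h
      rw [show 100 * (M + M * c + M * s) = (100 * M) * (1 + c + s) by ring,
        show |100 * x| * M = (100 * M) * |x| by
          rw [abs_mul, abs_of_pos (by norm_num : (0 : ℝ) < 100)]; ring,
        show |100 * y| * M = (100 * M) * |y| by
          rw [abs_mul, abs_of_pos (by norm_num : (0 : ℝ) < 100)]; ring,
        show |100 * x * (M * c) + 100 * y * (M * s)| = (100 * M) * |x * c + y * s| by
          rw [show 100 * x * (M * c) + 100 * y * (M * s) = (100 * M) * (x * c + y * s) by ring,
            abs_mul, abs_of_pos (by positivity : 0 < 100 * M)],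
        show |100 * y * (M * c) - 100 * x * (M * s)| = (100 * M) * |y * c - x * s| by
          rw [show 100 * y * (M * c) - 100 * x * (M * s) = (100 * M) * (y * c - x * s) by ring,
            abs_mul, abs_of_pos (by positivity : 0 < 100 * M)]] at h
      have h100 : 0 < 100 * M := by positivity
      simp only [mul_lt_mul_iff_right₀ h100] at h
      rcases h with h | h | h | h <;> linarith
    · exfalso
      rcases hde x y hxy with h' | h' <;> linarith [h.1, h.2]
    · obtain ⟨k, hk, rfl⟩ := List.getElem_of_mem hp
      refine ⟨⟨k, hL ▸ hk⟩, ?_⟩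
      unfold Pierced at h
      rw [eN, eC, eS] at h
      have h100 : 0 < 100 * M := by positivity
      constructor
      · refine le_of_mul_le_mul_left (a := 100 * M) ?_ h100
        refine le_trans (le_of_eq ?_) (h.1.trans (by linarith))
        rw [← abs_of_pos h100, ← abs_mul]
        congr 1
        simp only [Fin.getElem_fin]
        ring
      · refine le_of_mul_le_mul_left (a := 100 * M) ?_ h100
        refine le_trans (le_of_eq ?_) (h.2.trans (by linarith))
        rw [← abs_of_pos h100, ← abs_mul]
        congr 1
        simp only [Fin.getElem_fin]
        ring

/-! ### Greedy colouring -/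

/-- Remove a vertex of small degree, colour the rest by induction, and give the vertex a colour
missing on its neighbours. -/
theorem SimpleGraph.colorable_of_forall_exists_degree_lt {V : Type*} [Finite V] (G : SimpleGraph V)
    {k : ℕ} (h : ∀ A : Finset V, A.Nonempty → ∃ i ∈ A, {j | j ∈ A ∧ G.Adj i j}.ncard < k) :
    G.Colorable k := by
  classical
  have := Fintype.ofFinite V
  rcases isEmpty_or_nonempty V with hV | ⟨⟨v⟩⟩
  · exact ⟨SimpleGraph.Coloring.mk (fun v => isEmptyElim v) fun {v} => isEmptyElim v⟩
  have hk : 0 < k := by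
    obtain ⟨i, -, hi⟩ := h {v} (Finset.singleton_nonempty v)
    omega
  have key : ∀ n : ℕ, ∀ A : Finset V, A.card = n →
      ∃ f : V → Fin k, ∀ i ∈ A, ∀ j ∈ A, G.Adj i j → f i ≠ f j := by
    intro n
    induction n with
    | zero =>
      intro A hA
      rw [Finset.card_eq_zero] at hA
      subst hA
      exact ⟨fun _ => ⟨0, hk⟩, by simp⟩
    | succ n ih =>
      intro A hA
      obtain ⟨i, hi, hik⟩ := h A (Finset.card_pos.1 (by omega))
      obtain ⟨f, hf⟩ := ih (A.erase i) (by rw [Finset.card_erase_of_mem hi]; omega)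
      obtain ⟨c, hc⟩ : ∃ c, c ∉ f '' {j | j ∈ A ∧ G.Adj i j} := by
        by_contra! hall
        have h₁ : f '' {j | j ∈ A ∧ G.Adj i j} = Set.univ := Set.eq_univ_of_forall hall
        have h₂ := Set.ncard_image_le (f := f) (Set.toFinite {j | j ∈ A ∧ G.Adj i j})
        rw [h₁, Set.ncard_univ, Nat.card_fin] at h₂
        omega
      have hc' : ∀ j ∈ A, G.Adj i j → f j ≠ c := fun j hj hij he => hc ⟨j, ⟨hj, hij⟩, he⟩
      refine ⟨Function.update f i c, fun a ha b hb hab => ?_⟩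
      rcases eq_or_ne a i with rfl | hai
      · rw [Function.update_self, Function.update_of_ne hab.ne']
        exact (hc' b hb hab).symm
      · rw [Function.update_of_ne hai]
        rcases eq_or_ne b i with rfl | hbi
        · rw [Function.update_self]
          exact hc' a ha hab.symm
        · rw [Function.update_of_ne hbi]
          exact hf a (Finset.mem_erase.2 ⟨hai, ha⟩) b (Finset.mem_erase.2 ⟨hbi, hb⟩) hab
  obtain ⟨f, hf⟩ := key _ Finset.univ rfl
  exact ⟨SimpleGraph.Coloring.mk f fun {a b} hab =>
    hf a (Finset.mem_univ a) b (Finset.mem_univ b) hab⟩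

/-! ### Two squares that meet, in coordinates -/

theorem coordinates_eq {c s X Y : ℝ} (hcs : c ^ 2 + s ^ 2 = 1) :
    X = (X * c + Y * s) * c - (Y * c - X * s) * s ∧
      Y = (X * c + Y * s) * s + (Y * c - X * s) * c := by
  constructor
  · linear_combination -X * hcs
  · linear_combination -Y * hcs

/-- If a square with centre `(P, Q)` meets the quadrant `X, Y ≤ 0`, and if two of its corners lie
beyond the two sides of that quadrant, then it contains the apex of the quadrant. -/
theorem apex_mem {a c s P Q X Y : ℝ} (ha : 0 < a) (hs : 0 ≤ s) (hsc : s ≤ c)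
    (hcs : c ^ 2 + s ^ 2 = 1) (hX : X ≤ 0) (hY : Y ≤ 0) (hP : a * c - a * s < P)
    (hQ : a * s - a * c < Q) (hu₁ : -a ≤ (X - P) * c + (Y - Q) * s)
    (hv₁ : -a ≤ (Y - Q) * c - (X - P) * s) :
    (-a ≤ P * c + Q * s ∧ P * c + Q * s ≤ a) ∧ (-a ≤ Q * c - P * s ∧ Q * c - P * s ≤ a) := by
  have hc : 0 < c := by nlinarith
  have h₁ : P * c + Q * s ≤ a := by
    nlinarith [mul_nonneg hc.le (neg_nonneg.2 hX), mul_nonneg hs (neg_nonneg.2 hY)]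
  have h₂ : Q ≤ a * s + a * c := by
    have := (coordinates_eq (X := X - P) (Y := Y - Q) hcs).2
    nlinarith [mul_le_mul_of_nonneg_right hu₁ hs, mul_le_mul_of_nonneg_right hv₁ hc.le]
  have hPc := mul_le_mul_of_nonneg_right hP.le hc.le
  have hPs := mul_le_mul_of_nonneg_right hP.le hs
  have hQc := mul_le_mul_of_nonneg_right h₂ hc.le
  have hQs := mul_le_mul_of_nonneg_right hQ.le hs
  have ecs : a * (c ^ 2 + s ^ 2) = a := by rw [hcs, mul_one]
  refine ⟨⟨?_, h₁⟩, ?_, ?_⟩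
  · nlinarith [mul_nonneg ha.le (sq_nonneg (c - s))]
  · refine le_of_mul_le_mul_right (a := c) ?_ hc
    have e : (Q * c - P * s) * c = Q * (c ^ 2 + s ^ 2) - s * (P * c + Q * s) := by ring
    rw [e, hcs]
    nlinarith [mul_le_mul_of_nonneg_left h₁ hs]
  · nlinarith

/-- If a square with half side `a`, centre `(p, q)` and side directions `(c, s)`, `(-s, c)` meets
the square `[-b, b]²`, where `a ≤ b`, then one of them contains a corner of the other, or each of
them contains the centre of the other. -/
theorem exists_corner_or_centers {a b c s p q x y : ℝ} (ha : 0 < a) (hab : a ≤ b) (hs : 0 ≤ s)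
    (hsc : s ≤ c) (hcs : c ^ 2 + s ^ 2 = 1) (hx : |x| ≤ b) (hy : |y| ≤ b)
    (hu : |(x - p) * c + (y - q) * s| ≤ a) (hv : |(y - q) * c - (x - p) * s| ≤ a) :
    (∃ ξ η : ℝ, |ξ| = a ∧ |η| = a ∧ |p + ξ * c - η * s| ≤ b ∧ |q + ξ * s + η * c| ≤ b) ∨
    (∃ ξ η : ℝ, |ξ| = b ∧ |η| = b ∧ |(ξ - p) * c + (η - q) * s| ≤ a ∧
      |(η - q) * c - (ξ - p) * s| ≤ a) ∨
    (|p| ≤ b ∧ |q| ≤ b ∧ |p * c + q * s| ≤ a ∧ |q * c - p * s| ≤ a) := by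
  have hb : 0 < b := ha.trans_le hab
  have hc : 0 ≤ c := hs.trans hsc
  have hc1 : c ≤ 1 := by nlinarith
  have hs1 : s ≤ 1 := by nlinarith
  have hcs2 : c + s ≤ 3 / 2 := by nlinarith [sq_nonneg (c - s)]
  by_contra! hcon
  obtain ⟨hS, hT, hZ⟩ := hcon
  have haa : |a| = a := abs_of_pos ha
  have hna : |-a| = a := by rw [abs_neg, haa]
  have hbb : |b| = b := abs_of_pos hb
  have hnb : |-b| = b := by rw [abs_neg, hbb]
  rw [abs_le] at hx hy hu hv
  obtain ⟨hu1, hu2⟩ := hu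
  obtain ⟨hv1, hv2⟩ := hv
  have hAb : a * c ≤ b := by nlinarith
  have hBb : a * s ≤ b := by nlinarith
  have hB : 0 ≤ a * s := by positivity
  have hBA : a * s ≤ a * c := mul_le_mul_of_nonneg_left hsc ha.le
  obtain ⟨ex, ey⟩ := coordinates_eq (X := x - p) (Y := y - q) hcs
  have g1 := mul_le_mul_of_nonneg_right hu1 hc
  have g2 := mul_le_mul_of_nonneg_right hu2 hc
  have g3 := mul_le_mul_of_nonneg_right hu1 hs
  have g4 := mul_le_mul_of_nonneg_right hu2 hs
  have k1 := mul_le_mul_of_nonneg_right hv1 hc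
  have k2 := mul_le_mul_of_nonneg_right hv2 hc
  have k3 := mul_le_mul_of_nonneg_right hv1 hs
  have k4 := mul_le_mul_of_nonneg_right hv2 hs
  have mR : p - a * c - a * s ≤ b := by linarith
  have mL : -b ≤ p + a * c + a * s := by linarith
  have mU : q - a * c - a * s ≤ b := by linarith
  have mD : -b ≤ q + a * c + a * s := by linarith
  clear ex ey g1 g2 g3 g4 k1 k2 k3 k4
  -- `hN`, `hE`, `hW`, `hO` concern the top, right, left and bottom corner of the small square: a
  -- corner within the vertical strip of the big square lies above or below that square.
  have hN : -b ≤ p + a * c - a * s → p + a * c - a * s ≤ b →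
      q + a * c + a * s < -b ∨ b < q + a * c + a * s := fun h h' => by
    have := hS a a haa haa (abs_le.2 ⟨by linarith, by linarith⟩)
    rw [lt_abs] at this
    rcases this with h | h
    · right; linarith
    · left; linarith
  have hE : -b ≤ p + a * c + a * s → p + a * c + a * s ≤ b →
      q - a * c + a * s < -b ∨ b < q - a * c + a * s := fun h h' => by
    have := hS a (-a) haa hna (abs_le.2 ⟨by linarith, by linarith⟩)
    rw [lt_abs] at this
    rcases this with h | h
    · right; linarith
    · left; linarith
  have hW : -b ≤ p - a * c - a * s → p - a * c - a * s ≤ b →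
      q + a * c - a * s < -b ∨ b < q + a * c - a * s := fun h h' => by
    have := hS (-a) a hna haa (abs_le.2 ⟨by linarith, by linarith⟩)
    rw [lt_abs] at this
    rcases this with h | h
    · right; linarith
    · left; linarith
  have hO : -b ≤ p - a * c + a * s → p - a * c + a * s ≤ b →
      q - a * c - a * s < -b ∨ b < q - a * c - a * s := fun h h' => by
    have := hS (-a) (-a) hna hna (abs_le.2 ⟨by linarith, by linarith⟩)
    rw [lt_abs] at this
    rcases this with h | h
    · right; linarith
    · left; linarith
  -- The cases are whether the right and left corners leave the strip.
  rcases lt_or_ge b (p + a * c + a * s) with hR | hR <;>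
    rcases lt_or_ge (p - a * c - a * s) (-b) with hL | hL
  · -- all four sides of the big square cut off a corner of the small one
    have hN' : b < q + a * c + a * s := by
      rcases hN (by linarith) (by linarith) with h | h <;> linarith
    have hO' : q - a * c - a * s < -b := by
      rcases hO (by linarith) (by linarith) with h | h <;> linarith
    -- As `a ≤ b`, the centres differ by at most `m = a (c + s - 1)` in each coordinate, and `m (c +
    -- s) ≤ a`; hence each square contains the other centre.
    have hm : a * c + a * s - b ≤ a * (c + s - 1) := by linarith
    have hz : a * (c + s - 1) * c + a * (c + s - 1) * s ≤ a := by
      have : (c + s - 1) * (c + s) ≤ 1 := by nlinarith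
      nlinarith
    generalize a * (c + s - 1) = m at hm hz
    have p1 := mul_le_mul_of_nonneg_right (show p ≤ m by linarith) hc
    have p2 := mul_le_mul_of_nonneg_right (show -m ≤ p by linarith) hc
    have p3 := mul_le_mul_of_nonneg_right (show p ≤ m by linarith) hs
    have p4 := mul_le_mul_of_nonneg_right (show -m ≤ p by linarith) hs
    have q1 := mul_le_mul_of_nonneg_right (show q ≤ m by linarith) hc
    have q2 := mul_le_mul_of_nonneg_right (show -m ≤ q by linarith) hc
    have q3 := mul_le_mul_of_nonneg_right (show q ≤ m by linarith) hs
    have q4 := mul_le_mul_of_nonneg_right (show -m ≤ q by linarith) hs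
    exact absurd (hZ (abs_le.2 ⟨by linarith, by linarith⟩) (abs_le.2 ⟨by linarith, by linarith⟩)
      (abs_le.2 ⟨by linarith, by linarith⟩)) (not_lt.2 (abs_le.2 ⟨by linarith, by linarith⟩))
  · rcases hW hL mR with h | h
    · have hU : q + a * c + a * s ≤ b := by linarith
      have hN' : b < p + a * c - a * s := by
        by_contra! hc'
        rcases hN (by linarith) hc' with h | h <;> linarith
      -- Here and below, a quarter turn carries the relevant corner of the big square to the apex of
      -- the standard quadrant; it preserves the rotated directions up to sign and order.
      obtain ⟨⟨_, _⟩, _, _⟩ := apex_mem (P := -(q + b)) (Q := p - b)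
        (X := -(y + b)) (Y := x - b) ha hs hsc hcs (by linarith) (by linarith)
        (by linarith) (by linarith) (by linarith) (by linarith)
      exact absurd (hT b (-b) hbb hnb (abs_le.2 ⟨by linarith, by linarith⟩))
        (not_lt.2 (abs_le.2 ⟨by linarith, by linarith⟩))
    · have hO' : b < p - a * c + a * s := by
        by_contra! hc'
        rcases hO (by linarith) hc' with h | h <;> linarith
      obtain ⟨⟨_, _⟩, _, _⟩ := apex_mem (P := p - b) (Q := q - b)
        (X := x - b) (Y := y - b) ha hs hsc hcs (by linarith) (by linarith)
        (by linarith) (by linarith) (by linarith) (by linarith)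
      exact absurd (hT b b hbb hbb (abs_le.2 ⟨by linarith, by linarith⟩))
        (not_lt.2 (abs_le.2 ⟨by linarith, by linarith⟩))
  · rcases hE mL hR with h | h
    · have hN' : p + a * c - a * s < -b := by
        by_contra! hc'
        rcases hN hc' (by linarith) with h | h <;> linarith
      obtain ⟨⟨_, _⟩, _, _⟩ := apex_mem (P := -(p + b)) (Q := -(q + b))
        (X := -(x + b)) (Y := -(y + b)) ha hs hsc hcs (by linarith) (by linarith)
        (by linarith) (by linarith) (by linarith) (by linarith)
      exact absurd (hT (-b) (-b) hnb hnb (abs_le.2 ⟨by linarith, by linarith⟩))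
        (not_lt.2 (abs_le.2 ⟨by linarith, by linarith⟩))
    · have hO' : p - a * c + a * s < -b := by
        by_contra! hc'
        rcases hO hc' (by linarith) with h | h <;> linarith
      obtain ⟨⟨_, _⟩, _, _⟩ := apex_mem (P := q - b) (Q := -(p + b))
        (X := y - b) (Y := -(x + b)) ha hs hsc hcs (by linarith) (by linarith)
        (by linarith) (by linarith) (by linarith) (by linarith)
      exact absurd (hT (-b) b hnb hbb (abs_le.2 ⟨by linarith, by linarith⟩))
        (not_lt.2 (abs_le.2 ⟨by linarith, by linarith⟩))
  -- All corners are in the strip, the top one above and the bottom one below; the left one can be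
  -- neither, since `a c` and `a s` are at most `b`.
  · have hN' : b < q + a * c + a * s := by
      rcases hN (by linarith) (by linarith) with h | h <;> linarith
    have hO' : q - a * c - a * s < -b := by
      rcases hO (by linarith) (by linarith) with h | h <;> linarith
    rcases hW hL mR with h | h <;> linarith

/-! ### Orthonormal frames and squares as sets -/

/-- `u`, `v` is an orthonormal frame of the plane. -/
def IsFrame (u v : Plane) : Prop := ‖u‖ = 1 ∧ ‖v‖ = 1 ∧ ⟪u, v⟫_ℝ = 0

/-- Up to signs, `u'` and `v'` are `c u + s v` and `c v - s u`. -/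
def HasDirection (u v u' v' : Plane) (c s : ℝ) : Prop :=
  ∀ x, |⟪x, u'⟫_ℝ| = |⟪x, u⟫_ℝ * c + ⟪x, v⟫_ℝ * s| ∧
    |⟪x, v'⟫_ℝ| = |⟪x, v⟫_ℝ * c - ⟪x, u⟫_ℝ * s|

/-- The square with centre `z`, half side `h` and sides in the directions of `u`, `v`. -/
def squareSet (z u v : Plane) (h : ℝ) : Set Plane :=
  {x | |⟪x - z, u⟫_ℝ| ≤ h ∧ |⟪x - z, v⟫_ℝ| ≤ h}

/-- The corners of `squareSet z u v h`. -/
def cornerSet (z u v : Plane) (h : ℝ) : Set Plane :=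
  {x | |⟪x - z, u⟫_ℝ| = h ∧ |⟪x - z, v⟫_ℝ| = h}

theorem squareSet_swap (z u v : Plane) (h : ℝ) : squareSet z v u h = squareSet z u v h := by
  ext x; exact and_comm

theorem cornerSet_swap (z u v : Plane) (h : ℝ) : cornerSet z v u h = cornerSet z u v h := by
  ext x; exact and_comm

theorem squareSet_neg_left (z u v : Plane) (h : ℝ) : squareSet z (-u) v h = squareSet z u v h := by
  ext x; simp [squareSet, inner_neg_right]

theorem squareSet_neg_right (z u v : Plane) (h : ℝ) : squareSet z u (-v) h = squareSet z u v h := by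
  ext x; simp [squareSet, inner_neg_right]

theorem cornerSet_subset_squareSet (z u v : Plane) (h : ℝ) :
    cornerSet z u v h ⊆ squareSet z u v h :=
  fun _ hx => ⟨hx.1.le, hx.2.le⟩

theorem center_mem_squareSet (z u v : Plane) {h : ℝ} (hh : 0 ≤ h) : z ∈ squareSet z u v h := by
  simp [squareSet, hh]

namespace IsFrame

variable {u v u' v' : Plane}

theorem swap (h : IsFrame u v) : IsFrame v u :=
  ⟨h.2.1, h.1, by rw [real_inner_comm]; exact h.2.2⟩

theorem neg_left (h : IsFrame u v) : IsFrame (-u) v :=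
  ⟨by rw [norm_neg]; exact h.1, h.2.1, by rw [inner_neg_left, h.2.2, neg_zero]⟩

theorem neg_right (h : IsFrame u v) : IsFrame u (-v) := h.swap.neg_left.swap

theorem inner_left_self (h : IsFrame u v) : ⟪u, u⟫_ℝ = 1 := by
  rw [real_inner_self_eq_norm_sq, h.1, one_pow]

theorem inner_eq (h : IsFrame u v) (x y : Plane) :
    ⟪x, y⟫_ℝ = ⟪x, u⟫_ℝ * ⟪y, u⟫_ℝ + ⟪x, v⟫_ℝ * ⟪y, v⟫_ℝ := by
  have hon : Orthonormal ℝ ![u, v] := by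
    rw [orthonormal_vecCons_iff]
    refine ⟨h.1, fun i => ?_, ?_⟩
    · fin_cases i; exact h.2.2
    · rw [orthonormal_vecCons_iff]
      exact ⟨h.2.1, fun i => i.elim0, ⟨fun i => i.elim0, fun i => i.elim0⟩⟩
  have hs := OrthonormalBasis.sum_inner_mul_inner
    (OrthonormalBasis.mk hon (hon.linearIndependent.span_eq_top_of_card_eq_finrank' (by simp)).ge)
    x y
  simp only [OrthonormalBasis.coe_mk, Fin.sum_univ_two, Matrix.cons_val_zero, Matrix.cons_val_one]
    at hs
  rw [← hs, real_inner_comm y u, real_inner_comm y v]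

theorem inner_combination_left (h : IsFrame u v) (ξ η : ℝ) : ⟪ξ • u + η • v, u⟫_ℝ = ξ := by
  rw [inner_add_left, real_inner_smul_left, real_inner_smul_left, h.inner_left_self, h.swap.2.2]
  ring

theorem inner_combination_right (h : IsFrame u v) (ξ η : ℝ) : ⟪ξ • u + η • v, v⟫_ℝ = η := by
  rw [add_comm]; exact h.swap.inner_combination_left η ξ

theorem eq_combination (h : IsFrame u v) (x : Plane) : x = ⟪x, u⟫_ℝ • u + ⟪x, v⟫_ℝ • v := by
  refine ext_inner_right ℝ fun y => ?_
  rw [h.inner_eq x y, inner_add_left, real_inner_smul_left, real_inner_smul_left,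
    real_inner_comm u y, real_inner_comm v y]

/-- Relative to a frame, any other frame is given by a direction in the first quadrant, up to signs
and the order of its members. -/
theorem exists_direction (h : IsFrame u v) (h' : IsFrame u' v') :
    ∃ c s : ℝ, 0 ≤ c ∧ 0 ≤ s ∧ c ^ 2 + s ^ 2 = 1 ∧
      (HasDirection u v u' v' c s ∨ HasDirection u v v' u' c s) := by
  have aux : ∀ {u' v' : Plane}, IsFrame u' v' → 0 ≤ ⟪u', u⟫_ℝ * ⟪u', v⟫_ℝ →
      ∃ c s : ℝ, 0 ≤ c ∧ 0 ≤ s ∧ c ^ 2 + s ^ 2 = 1 ∧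
      HasDirection u v u' v' c s := by
    intro u' v' h' hpos
    have h₁ := h.inner_eq u' u'
    have h₂ := h'.inner_eq u u
    have h₃ := h'.inner_eq v v
    have h₄ := h'.inner_eq u v
    rw [h'.inner_left_self] at h₁
    rw [h.inner_left_self, real_inner_comm u' u, real_inner_comm v' u] at h₂
    rw [h.swap.inner_left_self, real_inner_comm u' v, real_inner_comm v' v] at h₃
    rw [h.2.2, real_inner_comm u' u, real_inner_comm v' u, real_inner_comm u' v,
      real_inner_comm v' v] at h₄
    have hx : ∀ x, |⟪x, u'⟫_ℝ| = |⟪x, u⟫_ℝ * ⟪u', u⟫_ℝ + ⟪x, v⟫_ℝ * ⟪u', v⟫_ℝ| := fun x => by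
      rw [h.inner_eq x u']
    have hy : ∀ x, |⟪x, v'⟫_ℝ| = |⟪x, v⟫_ℝ * ⟪u', u⟫_ℝ - ⟪x, u⟫_ℝ * ⟪u', v⟫_ℝ| := fun x => by
      rw [h.inner_eq x v', ← sq_eq_sq_iff_abs_eq_abs]
      linear_combination -⟪x, u⟫_ℝ ^ 2 * h₂ - ⟪x, v⟫_ℝ ^ 2 * h₃ - 2 * ⟪x, u⟫_ℝ * ⟪x, v⟫_ℝ * h₄ +
        (⟪x, u⟫_ℝ ^ 2 + ⟪x, v⟫_ℝ ^ 2) * h₁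
    rcases mul_nonneg_iff.1 hpos with ⟨hc, hs⟩ | ⟨hc, hs⟩
    · exact ⟨⟪u', u⟫_ℝ, ⟪u', v⟫_ℝ, hc, hs, by linarith, fun x => ⟨hx x, hy x⟩⟩
    · refine ⟨-⟪u', u⟫_ℝ, -⟪u', v⟫_ℝ, by linarith, by linarith, by linarith, fun x => ⟨?_, ?_⟩⟩
      · rw [hx, ← abs_neg]; congr 1; ring
      · rw [hy, ← abs_neg]; congr 1; ring
  rcases le_total 0 (⟪u', u⟫_ℝ * ⟪u', v⟫_ℝ) with hpos | hneg
  · obtain ⟨c, s, hc, hs, hcs, H⟩ := aux h' hpos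
    exact ⟨c, s, hc, hs, hcs, Or.inl H⟩
  -- Orthogonality of `u` and `v`, expanded in the other frame, makes the two products opposite.
  · have : 0 ≤ ⟪v', u⟫_ℝ * ⟪v', v⟫_ℝ := by
      have h₁ := h'.inner_eq u v
      rw [h.2.2, real_inner_comm u' u, real_inner_comm u' v, real_inner_comm v' u,
        real_inner_comm v' v] at h₁
      linarith
    obtain ⟨c, s, hc, hs, hcs, H⟩ := aux h'.swap this
    exact ⟨c, s, hc, hs, hcs, Or.inr H⟩

end IsFrame

/-! ### Corners, centres and piercing points of squares in the plane -/

theorem exists_corner_or_centers_aux {u v u' v' z w x : Plane} {a b c s : ℝ} (hF : IsFrame u v)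
    (ha : 0 < a) (hab : a ≤ b) (hs : 0 ≤ s) (hsc : s ≤ c) (hcs : c ^ 2 + s ^ 2 = 1)
    (H : HasDirection u v u' v' c s)
    (hx : x ∈ squareSet z u' v' a) (hx' : x ∈ squareSet w u v b) :
    (cornerSet z u' v' a ∩ squareSet w u v b).Nonempty ∨
    (cornerSet w u v b ∩ squareSet z u' v' a).Nonempty ∨
    (z ∈ squareSet w u v b ∧ w ∈ squareSet z u' v' a) := by
  have hzw : ∀ (y e : Plane), ⟪y - z, e⟫_ℝ = ⟪y - w, e⟫_ℝ - ⟪z - w, e⟫_ℝ := fun y e => by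
    rw [← inner_sub_left]; congr 1; abel
  obtain ⟨hx₁, hx₂⟩ := hx
  rw [(H _).1, hzw, hzw] at hx₁
  rw [(H _).2, hzw, hzw] at hx₂
  rcases exists_corner_or_centers ha hab hs hsc hcs hx'.1 hx'.2 hx₁ hx₂ with
    ⟨ξ, η, hξ, hη, h₁, h₂⟩ | ⟨ξ, η, hξ, hη, h₁, h₂⟩ | ⟨h₁, h₂, h₃, h₄⟩
  · left
    have e : z + ((ξ * c - η * s) • u + (ξ * s + η * c) • v) - z =
      (ξ * c - η * s) • u + (ξ * s + η * c) • v := by abel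
    have e' : z + ((ξ * c - η * s) • u + (ξ * s + η * c) • v) - w =
      (z - w) + ((ξ * c - η * s) • u + (ξ * s + η * c) • v) := by abel
    refine ⟨z + ((ξ * c - η * s) • u + (ξ * s + η * c) • v), ⟨?_, ?_⟩, ?_, ?_⟩
    · rw [e, (H _).1, hF.inner_combination_left, hF.inner_combination_right, ← hξ]
      congr 1; linear_combination ξ * hcs
    · rw [e, (H _).2, hF.inner_combination_left, hF.inner_combination_right, ← hη]
      congr 1; linear_combination η * hcs
    · rw [e', inner_add_left, hF.inner_combination_left]
      convert h₁ using 2; ring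
    · rw [e', inner_add_left, hF.inner_combination_right]
      convert h₂ using 2; ring
  · right; left
    have e : w + (ξ • u + η • v) - w = ξ • u + η • v := by abel
    refine ⟨w + (ξ • u + η • v), ⟨?_, ?_⟩, ?_, ?_⟩
    · rw [e, hF.inner_combination_left, hξ]
    · rw [e, hF.inner_combination_right, hη]
    · rw [(H _).1, hzw, hzw, e, hF.inner_combination_left, hF.inner_combination_right]
      exact h₁
    · rw [(H _).2, hzw, hzw, e, hF.inner_combination_left, hF.inner_combination_right]
      exact h₂
  · right; right
    have e : ∀ y : Plane, |⟪w - z, y⟫_ℝ| = |⟪z - w, y⟫_ℝ| := fun y => by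
      rw [← abs_neg, ← inner_neg_left, neg_sub]
    refine ⟨⟨h₁, h₂⟩, ?_, ?_⟩
    · rw [e, (H _).1]; exact h₃
    · rw [e, (H _).2]; exact h₄

/-- If two squares meet, then one of them contains a corner of the other, or each of them contains
the centre of the other. -/
theorem squareSet_corner_or_centers {u v u' v' z w : Plane} {a b : ℝ} (hF : IsFrame u v)
    (hF' : IsFrame u' v') (ha : 0 < a) (hab : a ≤ b)
    (hne : (squareSet z u' v' a ∩ squareSet w u v b).Nonempty) :
    (cornerSet z u' v' a ∩ squareSet w u v b).Nonempty ∨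
    (cornerSet w u v b ∩ squareSet z u' v' a).Nonempty ∨
    (z ∈ squareSet w u v b ∧ w ∈ squareSet z u' v' a) := by
  have key : ∀ {u' v' : Plane} {c s : ℝ}, 0 ≤ c → 0 ≤ s → c ^ 2 + s ^ 2 = 1 →
      HasDirection u v u' v' c s →
      (squareSet z u' v' a ∩ squareSet w u v b).Nonempty →
      (cornerSet z u' v' a ∩ squareSet w u v b).Nonempty ∨
      (cornerSet w u v b ∩ squareSet z u' v' a).Nonempty ∨
      (z ∈ squareSet w u v b ∧ w ∈ squareSet z u' v' a) := by
    intro u' v' c s hc hs hcs H ⟨x, hx, hx'⟩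
    rcases le_total s c with hsc | hsc
    · exact exists_corner_or_centers_aux hF ha hab hs hsc hcs H hx hx'
    -- Exchanging `u` and `v` exchanges `c` and `s`.
    · rw [← squareSet_swap w, ← cornerSet_swap w]
      rw [← squareSet_swap w] at hx'
      refine exists_corner_or_centers_aux hF.swap ha hab hc hsc (by linarith) (fun x => ?_) hx hx'
      rw [(H x).1, (H x).2, abs_sub_comm]
      exact ⟨by rw [add_comm], rfl⟩
  obtain ⟨c, s, hc, hs, hcs, H | H⟩ := hF.exists_direction hF'
  · exact key hc hs hcs H hne
  · rw [← squareSet_swap z, ← cornerSet_swap z]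
    rw [← squareSet_swap z] at hne
    exact key hc hs hcs H hne

/-- A farthest corner of a square is farther from the origin than all its other points. -/
theorem exists_mem_cornerSet_norm_lt {u v z x : Plane} {h : ℝ} (hF : IsFrame u v)
    (hx : x ∈ squareSet z u v h) (hx' : x ∉ cornerSet z u v h) :
    ∃ y ∈ cornerSet z u v h, ‖x‖ < ‖y‖ := by
  -- One coordinate at a time: the endpoint `±h` with the sign of `m` is farthest from `-m`.
  have aux : ∀ m ξ : ℝ, |ξ| ≤ h →
      ∃ ξ', |ξ'| = h ∧ (m + ξ) ^ 2 ≤ (m + ξ') ^ 2 ∧ (|ξ| ≠ h → (m + ξ) ^ 2 < (m + ξ') ^ 2) := by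
    intro m ξ hξ
    have h0 : 0 ≤ h := (abs_nonneg ξ).trans hξ
    obtain ⟨hl, hr⟩ := abs_le.1 hξ
    rcases le_total 0 m with hm | hm
    · refine ⟨h, abs_of_nonneg h0, by nlinarith, fun hne => ?_⟩
      obtain ⟨hl, hr⟩ := abs_lt.1 (lt_of_le_of_ne hξ hne)
      nlinarith
    · refine ⟨-h, by rw [abs_neg, abs_of_nonneg h0], by nlinarith, fun hne => ?_⟩
      obtain ⟨hl, hr⟩ := abs_lt.1 (lt_of_le_of_ne hξ hne)
      nlinarith
  have hnorm : ∀ y : Plane,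
      ‖y‖ ^ 2 = (⟪z, u⟫_ℝ + ⟪y - z, u⟫_ℝ) ^ 2 + (⟪z, v⟫_ℝ + ⟪y - z, v⟫_ℝ) ^ 2 := by
    intro y
    rw [← real_inner_self_eq_norm_sq, hF.inner_eq y y, ← inner_add_left, ← inner_add_left,
      add_sub_cancel]
    ring
  obtain ⟨ξ, hξ, hξ₁, hξ₂⟩ := aux ⟪z, u⟫_ℝ ⟪x - z, u⟫_ℝ hx.1
  obtain ⟨η, hη, hη₁, hη₂⟩ := aux ⟪z, v⟫_ℝ ⟪x - z, v⟫_ℝ hx.2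
  have e : z + (ξ • u + η • v) - z = ξ • u + η • v := by abel
  refine ⟨z + (ξ • u + η • v), ⟨?_, ?_⟩, ?_⟩
  · rw [e, hF.inner_combination_left, hξ]
  · rw [e, hF.inner_combination_right, hη]
  · refine lt_of_pow_lt_pow_left₀ 2 (norm_nonneg _) ?_
    rw [hnorm x, hnorm, e, hF.inner_combination_left, hF.inner_combination_right]
    by_cases hc : |⟪x - z, u⟫_ℝ| = h
    · have := hη₂ fun hc' => hx' ⟨hc, hc'⟩
      linarith
    · have := hξ₂ hc
      linarith

/-- The corner with given signs. -/
noncomputable def corner (z u v : Plane) (h : ℝ) (σ : Bool × Bool) : Plane :=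
  z + ((bif σ.1 then h else -h) • u + (bif σ.2 then h else -h) • v)

theorem mem_cornerSet_iff {u v z x : Plane} {h : ℝ} (hF : IsFrame u v) (hh : 0 ≤ h) :
    x ∈ cornerSet z u v h ↔ ∃ σ, corner z u v h σ = x := by
  constructor
  · rintro ⟨h₁, h₂⟩
    have hσ : ∀ r : ℝ, |r| = h → ∃ σ : Bool, (bif σ then h else -h) = r := by
      intro r hr
      rcases (abs_eq hh).1 hr with rfl | rfl
      exacts [⟨true, rfl⟩, ⟨false, rfl⟩]
    obtain ⟨σ, hσ₁⟩ := hσ _ h₁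
    obtain ⟨τ, hτ⟩ := hσ _ h₂
    refine ⟨(σ, τ), ?_⟩
    rw [corner, hσ₁, hτ, ← hF.eq_combination, add_sub_cancel]
  · rintro ⟨⟨σ, τ⟩, rfl⟩
    have e : ∀ y, z + y - z = y := fun y => by abel
    refine ⟨?_, ?_⟩
    · rw [corner, e, hF.inner_combination_left]
      cases σ <;> simp [abs_of_nonneg hh]
    · rw [corner, e, hF.inner_combination_right]
      cases τ <;> simp [abs_of_nonneg hh]

/-- Renaming and reversing the sides of a square brings any direction into slope between 0 and 1,
the range covered by the three sectors. -/
theorem IsFrame.exists_ordered {u v : Plane} (hF : IsFrame u v) {e : Plane} (he : e ≠ 0) :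
    ∃ u₁ v₁, IsFrame u₁ v₁ ∧ (∀ z h, squareSet z u₁ v₁ h = squareSet z u v h) ∧
      0 < ⟪e, u₁⟫_ℝ ∧ 0 ≤ ⟪e, v₁⟫_ℝ ∧ ⟪e, v₁⟫_ℝ ≤ ⟪e, u₁⟫_ℝ := by
  obtain ⟨u₁, hu₁, hs₁, he₁⟩ : ∃ u₁, IsFrame u₁ v ∧
      (∀ z h, squareSet z u₁ v h = squareSet z u v h) ∧ 0 ≤ ⟪e, u₁⟫_ℝ := by
    rcases le_total 0 ⟪e, u⟫_ℝ with h | h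
    · exact ⟨u, hF, fun _ _ => rfl, h⟩
    · exact ⟨-u, hF.neg_left, fun _ _ => squareSet_neg_left .., by rw [inner_neg_right]; linarith⟩
  obtain ⟨v₁, hv₁, hs₂, he₂⟩ : ∃ v₁, IsFrame u₁ v₁ ∧
      (∀ z h, squareSet z u₁ v₁ h = squareSet z u v h) ∧ 0 ≤ ⟪e, v₁⟫_ℝ := by
    rcases le_total 0 ⟪e, v⟫_ℝ with h | h
    · exact ⟨v, hu₁, hs₁, h⟩
    · exact ⟨-v, hu₁.neg_right, fun z h => (squareSet_neg_right ..).trans (hs₁ z h),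
        by rw [inner_neg_right]; linarith⟩
  have hpos : ¬ (⟪e, u₁⟫_ℝ = 0 ∧ ⟪e, v₁⟫_ℝ = 0) := fun h => he <| by
    rw [hv₁.eq_combination e, h.1, h.2, zero_smul, zero_smul, add_zero]
  rcases le_total ⟪e, v₁⟫_ℝ ⟪e, u₁⟫_ℝ with h | h
  · refine ⟨u₁, v₁, hv₁, hs₂, lt_of_le_of_ne he₁ fun h0 => hpos ⟨h0.symm, ?_⟩, he₂, h⟩
    linarith
  · refine ⟨v₁, u₁, hv₁.swap, fun z r => (squareSet_swap ..).trans (hs₂ z r),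
      lt_of_le_of_ne he₂ fun h0 => hpos ⟨?_, h0.symm⟩, he₁, h⟩
    linarith

/-- Six points, one of them in the square with centre `z`, such that each congruent square that
meets it and whose centre is not lower in the direction `e` contains one of the six points. -/
theorem exists_piercing_points_squareSet {u v e : Plane} (hF : IsFrame u v) (he : e ≠ 0) (z : Plane)
    {h : ℝ} (hh : 0 < h) :
    ∃ P : Fin 6 → Plane, P 0 ∈ squareSet z u v h ∧
      ∀ w u' v' : Plane, IsFrame u' v' → ⟪e, z⟫_ℝ ≤ ⟪e, w⟫_ℝ →
        (squareSet z u v h ∩ squareSet w u' v' h).Nonempty → ∃ k, P k ∈ squareSet w u' v' h := by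
  obtain ⟨u₁, v₁, hF₁, hset, hd₁, hd₂, hd⟩ := hF.exists_ordered he
  obtain ⟨Q, hQ₁, hQ₂, hQ⟩ := exists_piercing_points hd₁ hd₂ hd
  rw [← hset]
  have hsub : ∀ y, z + y - z = y := fun y => by abel
  refine ⟨fun k => z + ((h * (Q k).1) • u₁ + (h * (Q k).2) • v₁), ⟨?_, ?_⟩, ?_⟩
  · rw [hsub, hF₁.inner_combination_left, abs_mul, abs_of_pos hh]
    exact mul_le_of_le_one_right hh.le hQ₁
  · rw [hsub, hF₁.inner_combination_right, abs_mul, abs_of_pos hh]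
    exact mul_le_of_le_one_right hh.le hQ₂
  have key : ∀ (w u' v' : Plane) (c s : ℝ), 0 ≤ c → 0 ≤ s → c ^ 2 + s ^ 2 = 1 →
      HasDirection u₁ v₁ u' v' c s →
      ⟪e, z⟫_ℝ ≤ ⟪e, w⟫_ℝ → (squareSet z u₁ v₁ h ∩ squareSet w u' v' h).Nonempty →
      ∃ k, z + ((h * (Q k).1) • u₁ + (h * (Q k).2) • v₁) ∈ squareSet w u' v' h := by
    rintro w u' v' c s hc hs hcs H hzw ⟨x, ⟨hx₁, hx₂⟩, hx₃, hx₄⟩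
    have hw : ∀ (y f : Plane), ⟪y - w, f⟫_ℝ = ⟪y - z, f⟫_ℝ - ⟪w - z, f⟫_ℝ := fun y f => by
      rw [← inner_sub_left]; congr 1; abel
    rw [(H _).1, hw, hw] at hx₃
    rw [(H _).2, hw, hw] at hx₄
    have hX : ∃ X, ⟪w - z, u₁⟫_ℝ = h * X := ⟨⟪w - z, u₁⟫_ℝ / h, by field_simp⟩
    have hY : ∃ Y, ⟪w - z, v₁⟫_ℝ = h * Y := ⟨⟪w - z, v₁⟫_ℝ / h, by field_simp⟩
    obtain ⟨X, hX⟩ := hX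
    obtain ⟨Y, hY⟩ := hY
    rw [hX, hY] at hx₃ hx₄
    have hd : 0 ≤ ⟪e, u₁⟫_ℝ * X + ⟪e, v₁⟫_ℝ * Y := by
      have := hF₁.inner_eq e (w - z)
      rw [inner_sub_right, hX, hY] at this
      refine nonneg_of_mul_nonneg_right (a := h) ?_ hh
      linarith
    obtain ⟨ex, ey⟩ := coordinates_eq (X := ⟪x - z, u₁⟫_ℝ - h * X) (Y := ⟪x - z, v₁⟫_ℝ - h * Y) hcs
    rw [abs_le] at hx₁ hx₂ hx₃ hx₄
    have m₁ := mul_le_mul_of_nonneg_right hx₁.1 hc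
    have m₂ := mul_le_mul_of_nonneg_right hx₁.2 hc
    have m₃ := mul_le_mul_of_nonneg_right hx₂.1 hc
    have m₄ := mul_le_mul_of_nonneg_right hx₂.2 hc
    have m₅ := mul_le_mul_of_nonneg_right hx₃.1 hc
    have m₆ := mul_le_mul_of_nonneg_right hx₃.2 hc
    have m₇ := mul_le_mul_of_nonneg_right hx₄.1 hc
    have m₈ := mul_le_mul_of_nonneg_right hx₄.2 hc
    have n₁ := mul_le_mul_of_nonneg_right hx₁.1 hs
    have n₂ := mul_le_mul_of_nonneg_right hx₁.2 hs
    have n₃ := mul_le_mul_of_nonneg_right hx₂.1 hs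
    have n₄ := mul_le_mul_of_nonneg_right hx₂.2 hs
    have n₅ := mul_le_mul_of_nonneg_right hx₃.1 hs
    have n₆ := mul_le_mul_of_nonneg_right hx₃.2 hs
    have n₇ := mul_le_mul_of_nonneg_right hx₄.1 hs
    have n₈ := mul_le_mul_of_nonneg_right hx₄.2 hs
    have scale : ∀ r R : ℝ, -(h * R) ≤ h * r → h * r ≤ h * R → |r| ≤ R := fun r R h₁ h₂ =>
      abs_le.2 ⟨le_of_mul_le_mul_left (by linarith) hh, le_of_mul_le_mul_left h₂ hh⟩
    obtain ⟨k, hk₁, hk₂⟩ := hQ X Y c s hc hs hcs hd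
      (scale _ _ (by linarith) (by linarith)) (scale _ _ (by linarith) (by linarith))
      (scale _ _ (by linarith) (by linarith)) (scale _ _ (by linarith) (by linarith))
    refine ⟨k, ?_, ?_⟩
    · rw [(H _).1, hw, hw, hsub, hF₁.inner_combination_left, hF₁.inner_combination_right, hX, hY,
        show (h * (Q k).1 - h * X) * c + (h * (Q k).2 - h * Y) * s =
          h * (((Q k).1 - X) * c + ((Q k).2 - Y) * s) by ring, abs_mul, abs_of_pos hh]
      exact mul_le_of_le_one_right hh.le hk₁
    · rw [(H _).2, hw, hw, hsub, hF₁.inner_combination_left, hF₁.inner_combination_right, hX, hY,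
        show (h * (Q k).2 - h * Y) * c - (h * (Q k).1 - h * X) * s =
          h * (((Q k).2 - Y) * c - ((Q k).1 - X) * s) by ring, abs_mul, abs_of_pos hh]
      exact mul_le_of_le_one_right hh.le hk₂
  intro w u' v' hF' hzw hne
  obtain ⟨c, s, hc, hs, hcs, H | H⟩ := hF₁.exists_direction hF'
  · exact key w u' v' c s hc hs hcs H hzw hne
  · rw [← squareSet_swap w] at hne ⊢
    exact key w v' u' c s hc hs hcs H hzw hne

theorem isSquareOfSide_iff {r : ℝ} {S : Set Plane} :
    IsSquareOfSide r S ↔ 0 < r ∧ ∃ z u v, IsFrame u v ∧ S = squareSet z u v (r / 2) := by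
  constructor
  · rintro ⟨hr, z, u, v, hu, hv, huv, rfl⟩
    exact ⟨hr, z, u, v, ⟨hu, hv, huv⟩, rfl⟩
  · rintro ⟨hr, z, u, v, ⟨hu, hv, huv⟩, rfl⟩
    exact ⟨hr, z, u, v, hu, hv, huv, rfl⟩

/-! ### Degeneracy of families of squares -/

section Family

variable {ι : Type*} [Finite ι] (C : ι → Set Plane)

theorem pointDegree_le_maxPointDegree (p : Plane) : pointDegree C p ≤ maxPointDegree C :=
  (isGreatest_maxPointDegree C).2 ⟨p, rfl⟩

theorem ncard_other_lt_maxPointDegree {i : ι} {p : Plane} (hp : p ∈ C i) :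
    {j | j ≠ i ∧ p ∈ C j}.ncard < maxPointDegree C :=
  lt_of_lt_of_le (Set.ncard_lt_ncard ⟨fun _ hj => hj.2, fun h => (h hp).1 rfl⟩)
    (pointDegree_le_maxPointDegree C p)

theorem colorable_of_equal_size {r : ℝ} (hC : ∀ i, IsSquareOfSide r (C i)) :
    (intersectionGraph C).Colorable (6 * maxPointDegree C) := by
  choose hr z u v hF hCz using fun i => isSquareOfSide_iff.1 (hC i)
  refine SimpleGraph.colorable_of_forall_exists_degree_lt _ fun A hA => ?_
  obtain ⟨e, he⟩ := exists_ne (0 : Plane)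
  obtain ⟨i, hi, hmin⟩ := A.exists_min_image (fun i => ⟪e, z i⟫_ℝ) hA
  refine ⟨i, hi, ?_⟩
  obtain ⟨P, hP₀, hP⟩ := exists_piercing_points_squareSet (hF i) he (z i) (half_pos (hr i))
  rw [← hCz] at hP₀ hP
  have hsub : {j | j ∈ A ∧ (intersectionGraph C).Adj i j} ⊆ ⋃ k, {j | j ≠ i ∧ P k ∈ C j} := by
    rintro j ⟨hj, hij, hne⟩
    rw [hCz j] at hne
    obtain ⟨k, hk⟩ := hP _ _ _ (hF j) (hmin j hj) hne
    exact Set.mem_iUnion.2 ⟨k, hij.symm, by rw [hCz j]; exact hk⟩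
  calc _ ≤ _ := Set.ncard_le_ncard hsub
    _ ≤ ∑ k, {j | j ≠ i ∧ P k ∈ C j}.ncard := Set.ncard_iUnion_le_of_fintype _
    _ < ∑ _k : Fin 6, maxPointDegree C := by
      -- Strictness comes from the point `P 0`, which lies in `C i` itself.
      refine Finset.sum_lt_sum (fun k _ => ?_) ⟨0, Finset.mem_univ _, ?_⟩
      · exact (Set.ncard_le_ncard fun j hj => hj.2).trans (pointDegree_le_maxPointDegree C (P k))
      · exact ncard_other_lt_maxPointDegree C hP₀
    _ = 6 * maxPointDegree C := by simp

open Classical in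
theorem colorable_of_isPlaneSquare (hC : ∀ i, IsPlaneSquare (C i)) (hD : 2 ≤ maxPointDegree C) :
    (intersectionGraph C).Colorable (9 * (maxPointDegree C - 1)) := by
  choose r hC using hC
  choose hr z u v hF hCz using fun i => isSquareOfSide_iff.1 (hC i)
  refine SimpleGraph.colorable_of_forall_exists_degree_lt _ fun A hA => ?_
  obtain ⟨D, hD'⟩ : ∃ D, maxPointDegree C = D + 1 := ⟨maxPointDegree C - 1, by omega⟩
  rw [hD', Nat.add_sub_cancel]
  rw [hD'] at hD
  have hh : ∀ i, 0 ≤ r i / 2 := fun i => (half_pos (hr i)).le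
  set K : ι → Bool × Bool → Plane := fun i => corner (z i) (u i) (v i) (r i / 2) with hK
  have hKC : ∀ {i x}, x ∈ cornerSet (z i) (u i) (v i) (r i / 2) ↔ ∃ σ, K i σ = x := fun {i x} =>
    mem_cornerSet_iff (hF i) (hh i)
  have hKmem : ∀ i σ, K i σ ∈ C i := fun i σ => by
    rw [hCz i]; exact cornerSet_subset_squareSet _ _ _ _ (hKC.2 ⟨σ, rfl⟩)
  -- the weight that `i` charges to `j`
  let n : ι → Plane → ι → ℕ := fun i p j => if j ≠ i ∧ p ∈ C j then 1 else 0
  let w : ι → ι → ℕ := fun i j => 2 * ∑ σ, n i (K i σ) j + n i (z i) j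
  have hn : ∀ i p, p ∈ C i → ∑ j ∈ A, n i p j ≤ D := by
    intro i p hp
    have h₁ := ncard_other_lt_maxPointDegree C hp
    have h₂ : ∑ j ∈ A, n i p j ≤ {j | j ≠ i ∧ p ∈ C j}.ncard := by
      rw [← Finset.card_filter, ← Set.ncard_coe_finset]
      exact Set.ncard_le_ncard fun j hj => (Finset.mem_filter.1 hj).2
    omega
  have hsum : ∀ i, ∑ j ∈ A, w i j = 2 * ∑ σ, ∑ j ∈ A, n i (K i σ) j + ∑ j ∈ A, n i (z i) j := by
    intro i
    rw [Finset.sum_comm, Finset.mul_sum, ← Finset.sum_add_distrib]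
  have hzmem : ∀ i, z i ∈ C i := fun i => by
    rw [hCz i]; exact center_mem_squareSet _ _ _ (hh i)
  have hw : ∀ i, ∑ j ∈ A, w i j ≤ 9 * D := by
    intro i
    have h₁ : ∑ σ, ∑ j ∈ A, n i (K i σ) j ≤ ∑ _σ : Bool × Bool, D :=
      Finset.sum_le_sum fun σ _ => hn i _ (hKmem i σ)
    have h₂ := hn i (z i) (hzmem i)
    rw [Finset.sum_const, Finset.card_univ, Fintype.card_prod, Fintype.card_bool] at h₁
    rw [hsum]
    simp only [smul_eq_mul] at h₁
    omega
  have hnK : ∀ {i j σ}, j ≠ i → K i σ ∈ C j → 2 ≤ w i j := by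
    intro i j σ hij hmem
    have h₁ : n i (K i σ) j ≤ ∑ σ, n i (K i σ) j :=
      Finset.single_le_sum (f := fun σ => n i (K i σ) j) (fun _ _ => Nat.zero_le _)
        (Finset.mem_univ σ)
    have h₂ : n i (K i σ) j = 1 := if_pos ⟨hij, hmem⟩
    change 2 ≤ 2 * _ + _
    omega
  have hadj : ∀ i j, (if (intersectionGraph C).Adj i j then 2 else 0) ≤ w i j + w j i := by
    intro i j
    split_ifs with hij
    swap
    · exact Nat.zero_le _
    have key : ∀ i j, i ≠ j → (C i ∩ C j).Nonempty → r i / 2 ≤ r j / 2 → 2 ≤ w i j + w j i := by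
      intro i j hij hne hle
      rw [hCz i, hCz j] at hne
      rcases squareSet_corner_or_centers (hF j) (hF i) (half_pos (hr i)) hle hne with
        ⟨x, hx, hx'⟩ | ⟨x, hx, hx'⟩ | ⟨h₁, h₂⟩
      · obtain ⟨σ, rfl⟩ := hKC.1 hx
        rw [← hCz j] at hx'
        exact le_add_right (hnK hij.symm hx')
      · obtain ⟨σ, rfl⟩ := hKC.1 hx
        rw [← hCz i] at hx'
        exact le_add_left (hnK hij hx')
      · rw [← hCz j] at h₁
        rw [← hCz i] at h₂
        have h₃ : n i (z i) j = 1 := if_pos ⟨hij.symm, h₁⟩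
        have h₄ : n j (z j) i = 1 := if_pos ⟨hij, h₂⟩
        change 2 ≤ (2 * _ + _) + (2 * _ + _)
        omega
    rcases le_total (r i / 2) (r j / 2) with hle | hle
    · exact key i j hij.1 hij.2 hle
    · rw [add_comm]
      exact key j i hij.1.symm (by rw [Set.inter_comm]; exact hij.2) hle
  by_contra! hcon
  have hdeg : ∀ i ∈ A, 2 * (9 * D) ≤ ∑ j ∈ A, if (intersectionGraph C).Adj i j then 2 else 0 := by
    intro i hi
    have h₁ : {j | j ∈ A ∧ (intersectionGraph C).Adj i j} =
        (A.filter fun j => (intersectionGraph C).Adj i j : Set ι) := by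
      ext j; simp
    have h₂ := hcon i hi
    rw [h₁, Set.ncard_coe_finset, Finset.card_filter] at h₂
    calc _ ≤ 2 * _ := Nat.mul_le_mul_left 2 h₂
      _ = _ := by rw [Finset.mul_sum]; exact Finset.sum_congr rfl fun j _ => by split_ifs <;> rfl
  have hdouble : ∑ i ∈ A, ∑ j ∈ A, (w i j + w j i) = ∑ i ∈ A, 2 * ∑ j ∈ A, w i j := by
    simp only [Finset.sum_add_distrib]
    rw [Finset.sum_comm (f := fun i j => w j i), ← Finset.sum_add_distrib]
    exact Finset.sum_congr rfl fun i _ => (two_mul _).symm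
  have hle₁ : ∀ i ∈ A, (∑ j ∈ A, if (intersectionGraph C).Adj i j then 2 else 0) ≤
      ∑ j ∈ A, (w i j + w j i) := fun i _ => Finset.sum_le_sum fun j _ => hadj i j
  have hle₂ : ∀ i ∈ A, 2 * ∑ j ∈ A, w i j ≤ 2 * (9 * D) := fun i _ => Nat.mul_le_mul_left 2 (hw i)
  have htotal₁ := Finset.sum_le_sum hdeg
  have htotal₂ := Finset.sum_le_sum hle₁
  have htotal₃ := Finset.sum_le_sum hle₂
  -- a corner farthest from the origin
  obtain ⟨⟨i, σ⟩, hi, hmax⟩ := (A ×ˢ (Finset.univ : Finset (Bool × Bool))).exists_max_image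
    (fun q => ‖K q.1 q.2‖) (hA.product Finset.univ_nonempty)
  have hiA : i ∈ A := (Finset.mem_product.1 hi).1
  -- The totals form a chain from `2 · 9D · |A|` back to itself, so each inequality is an equality
  -- for every member.
  have hfull : 2 * ∑ j ∈ A, w i j = 2 * (9 * D) :=
    (Finset.sum_eq_sum_iff_of_le hle₂).1 (by omega) i hiA
  -- A total of `9D` forces each of the four corners to be in exactly `D` other members of `A`, and
  -- `D ≥ 1`.
  have hcount : ∑ j ∈ A, n i (K i σ) j = D := by
    have h₁ : ∑ τ, ∑ j ∈ A, n i (K i τ) j ≤ ∑ _τ : Bool × Bool, D :=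
      Finset.sum_le_sum fun τ _ => hn i _ (hKmem i τ)
    refine (Finset.sum_eq_sum_iff_of_le (fun τ _ => hn i _ (hKmem i τ))).1 ?_ σ (Finset.mem_univ σ)
    have h₂ := hn i (z i) (hzmem i)
    have h₃ := hsum i
    rw [Finset.sum_const, Finset.card_univ, Fintype.card_prod, Fintype.card_bool] at h₁ ⊢
    simp only [smul_eq_mul] at h₁ ⊢
    omega
  obtain ⟨j, hj, hnj⟩ : ∃ j ∈ A, n i (K i σ) j ≠ 0 :=
    Finset.exists_ne_zero_of_sum_ne_zero (by rw [hcount]; omega)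
  obtain ⟨hji, hKj⟩ : j ≠ i ∧ K i σ ∈ C j := by
    by_contra hc
    exact hnj (if_neg hc)
  -- Otherwise `C j` has a corner farther from the origin.
  obtain ⟨τ, hτ⟩ : ∃ τ, K j τ = K i σ := by
    by_contra hc
    obtain ⟨y, hy, hlt⟩ := exists_mem_cornerSet_norm_lt (hF j) (by rw [← hCz j]; exact hKj)
      (fun h => hc (hKC.1 h))
    obtain ⟨τ, rfl⟩ := hKC.1 hy
    exact absurd (hmax (j, τ) (Finset.mem_product.2 ⟨hj, Finset.mem_univ _⟩)) (not_le.2 hlt)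
  -- The shared corner is charged in both directions, 4 in total, whereas tightness allows at most
  -- 2.
  have h₁ := hnK hji hKj
  have h₂ : 2 ≤ w j i := hnK hji.symm (σ := τ) (by rw [hτ]; exact hKmem i σ)
  have h₃ : (∑ j ∈ A, if (intersectionGraph C).Adj i j then 2 else 0) = ∑ j ∈ A, (w i j + w j i) :=
    (Finset.sum_eq_sum_iff_of_le hle₁).1 (by omega) i hiA
  have h₄ := (Finset.sum_eq_sum_iff_of_le fun j _ => hadj i j).1 h₃ j hj
  split_ifs at h₄ <;> omega

end Family

theorem theorem1p4 {ι : Type*} [Finite ι] (C : ι → Set Plane) :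
    ((∀ i, IsPlaneSquare (C i)) → 2 ≤ maxPointDegree C →
      familyChromaticNumber C ≤ ((9 * (maxPointDegree C - 1) : ℕ) : ℕ∞)) ∧
    ((∃ s : ℝ, ∀ i, IsSquareOfSide s (C i)) →
      familyChromaticNumber C ≤ ((6 * maxPointDegree C : ℕ) : ℕ∞)) :=
  ⟨fun hC hD => (colorable_of_isPlaneSquare C hC hD).chromaticNumber_le,
    fun ⟨_, hC⟩ => (colorable_of_equal_size C hC).chromaticNumber_le⟩
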